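/- Fix a positive integer $r$. For $n\ge 0$, an $r$-parking function of length $n$ is an $n$-tuple of positive integers whose weakly increasing rearrangement $b_1\le\cdots\le b_n$ satisfies $b_j\le 1+(j-1)r$ for all $j$. For a finite set $C$ with an action of the symmetric group $\mathfrak S_n$, its Frobenius characteristic is the symmetric function $$\frac1{n!}\sum_{w\in\mathfrak S_n}\#\{c\in C: w\cdot c=c\}\;p_{\rho(w)},$$ where $\rho(w)$ is the cycle type of $w$ (fixed points included) and $p_\lambda$ is the power sum symmetric function in infinitely many variables. Let $F_n^{(r)}$ be the Frobenius characteristic of the action of $\mathfrak S_n$ by permuting coordinates on the set of $r$-parking functions of length $n$, let $\mathcal P^{(r)}(t)=\sum_{n\ge0}F_n^{(r)}t^n$ (so $F_0^{(r)}=1$), and for a positive integer $k$ define $G_n^{(r,k)}$, $n\ge1$, by $$\mathcal P^{(r)}(t)^{-k}=1-\sum_{n\ge1}G_n^{(r,k)}t^n .$$ Theorem. Let $n,r,k$ be positive integers with $rn-k>0$. For $w\in[k]=\{1,\dots,k\}$ let $q(w)$ be the smallest integer with $w\le q(w)r$. Let $S_n^{(r,k)}$ be the set of integer $n$-tuples whose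 weakly increasing rearrangement has the form $$(\underbrace{w,\dots,w}_{q(w)},\,b_{q(w)+1},\dots,b_n)$$ for some $w\in[k]$, where $$b_j\le\min\{(j-1)r,\;w-1+rn-k\}\quad\text{for } q(w)+1\le j\le n.\tag{1}$$ Then $S_n^{(r,k)}$ is finite, and $G_n^{(r,k)}$ is the Frobenius characteristic of the action of $\mathfrak S_n$ on $S_n^{(r,k)}$ by permuting coordinates. Moreover: (a) For every $w\in[k]$ we have $q(w)\le n$, and $w\le\min\{(j-1)r,\,w-1+rn-k\}$ for all $j\ge q(w)+1$. (b) For a weakly increasing integer sequence $b_1\le\cdots\le b_n$ and $w\in[k]$ with $b_1=\cdots=b_{q(w)}=w$, condition (1) is equivalent to: $b_j\le\min\{(j-1)r,\,w-1+rn-k\}$ for every $j\in[n]$ with $b_j>w$. (c) A weakly increasing integer sequence $b=(b_1,\dots,b_n)$ belongs to $S_n^{(r,k)}$ if and only if there is $w\in[k]$ such that I. $b_1=w$ and $b_n-b_1<rn-k$; II. $b_{q(w)}=w$; III. $b_j\le(j-1)r$ for all $j\in[n]$ with $b_j>w$. -/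

import Mathlib

namespace ParkingDual

open Equiv

/-! ### Symmetric functions, as formal power series in infinitely many variables -/

/-- Formal power series over `ℚ` in countably many variables; symmetric functions live here. -/
abbrev SymRing : Type := MvPowerSeries ℕ ℚ

open Classical in
/-- The power sum `p_m = ∑_i x_i ^ m` (used for `m ≥ 1`): the coefficient of a monomial is `1` if
the monomial is `x_i ^ m` for some `i`, and `0` otherwise. -/
noncomputable def powerSum (m : ℕ) : SymRing :=
  fun d => if ∃ i : ℕ, d = Finsupp.single i m then 1 else 0

/-- `p_λ = p_{λ₁} p_{λ₂} ⋯` for a partition `λ`. -/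
noncomputable def powerSumPart {n : ℕ} (p : n.Partition) : SymRing :=
  (p.parts.map powerSum).prod

/-- The Frobenius characteristic of an action of `𝔖_n` on a (finite) set `C`:
`(1/n!) ∑_w Fix(w) p_{ρ(w)}`, where `ρ(w)` is the cycle type of `w`, with fixed points counted as
cycles of length one. -/
noncomputable def frobeniusChar (n : ℕ) (C : Type) [MulAction (Perm (Fin n)) C] : SymRing :=
  ((n.factorial : ℚ)⁻¹) •
    ∑ w : Perm (Fin n), (Nat.card (MulAction.fixedBy C w) : ℚ) • powerSumPart w.partition

/-! ### Tuples, with `𝔖_n` permuting coordinates -/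

/-- `𝔖_n` acts on `n`-tuples by permuting coordinates: `(σ • a) i = a (σ⁻¹ i)`. -/
instance permTuples (n : ℕ) : MulAction (Perm (Fin n)) (Fin n → ℤ) := arrowAction

/-- The weakly increasing rearrangement of a tuple. -/
def incr {n : ℕ} (a : Fin n → ℤ) : Fin n → ℤ := a ∘ Tuple.sort a

theorem incr_smul {n : ℕ} (σ : Perm (Fin n)) (a : Fin n → ℤ) : incr (σ • a) = incr a :=
  Tuple.comp_perm_comp_sort_eq_comp_sort (f := a) (σ := σ⁻¹)

/-- The set of `(r,k)`-parking functions of length `n`: tuples of positive integers whose increasing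
rearrangement `b₁ ≤ ⋯ ≤ b_n` satisfies `b_j ≤ k + (j-1) r`. The coordinate `b_j` is `b i` for the
element `i = j - 1` of `Fin n`. -/
def parking (r k n : ℕ) : SubMulAction (Perm (Fin n)) (Fin n → ℤ) where
  carrier := {a | (∀ i, 1 ≤ a i) ∧ ∀ i : Fin n, incr a i ≤ (k : ℤ) + (i : ℤ) * r}
  smul_mem' σ a ha := ⟨fun i => ha.1 (σ⁻¹ i), by rw [incr_smul]; exact ha.2⟩

/-- `F_n^{(r,k)}`, the Frobenius characteristic of `𝔖_n` on `(r,k)`-parking functions. -/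
noncomputable def parkingSym (r k n : ℕ) : SymRing := frobeniusChar n (parking r k n)

/-- `𝒫^{(r)}(t) = ∑_{n ≥ 0} F_n^{(r,1)} t^n`. -/
noncomputable def parkingSeries (r : ℕ) : PowerSeries SymRing :=
  PowerSeries.mk fun n => parkingSym r 1 n

theorem constantCoeff_parkingSeries (r : ℕ) :
    PowerSeries.constantCoeff (parkingSeries r) = 1 := by
  have h : ∀ w : Perm (Fin 0), Nat.card (MulAction.fixedBy (parking r 1 0) w) = 1 := by
    intro w
    rw [Nat.card_eq_one_iff_unique]
    refine ⟨⟨fun a b => ?_⟩, ⟨⟨⟨fun i => i.elim0, fun i => i.elim0, fun i => i.elim0⟩, ?_⟩⟩⟩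
    · apply Subtype.ext; apply Subtype.ext; exact Subsingleton.elim _ _
    · apply Subtype.ext; exact Subsingleton.elim _ _
  have h2 : ∀ w : Perm (Fin 0), powerSumPart w.partition = 1 := by
    intro w
    have : w.partition.parts = 0 := by
      rw [Subsingleton.elim w 1]; simp [Equiv.Perm.partition]
    simp [powerSumPart, this]
  rw [← PowerSeries.coeff_zero_eq_constantCoeff_apply]
  simp only [parkingSeries, PowerSeries.coeff_mk, parkingSym, frobeniusChar, h, h2]
  simp

/-- The negative power `𝒫^{(r)}(t)^{-k}`, the multiplicative inverse of `𝒫^{(r)}(t)^k`. -/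
noncomputable def negPow (r k : ℕ) : PowerSeries SymRing :=
  PowerSeries.invOfUnit (parkingSeries r ^ k) 1

theorem parkingSeries_pow_mul_negPow (r k : ℕ) : parkingSeries r ^ k * negPow r k = 1 :=
  PowerSeries.mul_invOfUnit _ _ (by simp [constantCoeff_parkingSeries])

/-- `G_n^{(r,k)}` for `n ≥ 1`: minus the coefficient of `t^n` in `𝒫^{(r)}(t)^{-k}`. -/
noncomputable def dualSym (r k n : ℕ) : SymRing := -PowerSeries.coeff n (negPow r k)

/-- `𝒫^{(r)}(t)^{-k} = 1 - ∑_{n ≥ 1} G_n^{(r,k)} t^n`. -/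
theorem negPow_eq (r k : ℕ) :
    negPow r k = 1 - PowerSeries.mk fun n => if n = 0 then 0 else dualSym r k n := by
  ext1 n
  rcases Nat.eq_zero_or_pos n with rfl | hn
  · simp [negPow]
  · simp [dualSym, PowerSeries.coeff_one, hn.ne']

/-! ### The dual set `S_n^{(r,k)}` -/

/-- `q(w)`, the smallest integer with `w ≤ q(w) r` (for `w, r ≥ 1`). -/
noncomputable def qmin (r w : ℕ) : ℕ := sInf {q : ℕ | w ≤ q * r}

/-- The bound `min {(j-1) r, w - 1 + rn - k}` on `b_j`. -/
def dualBound (r k n w j : ℕ) : ℤ :=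
  min (((j : ℤ) - 1) * r) ((w : ℤ) - 1 + (r : ℤ) * n - k)

/-- The sequence `b` has the form `(w, …, w, b_{q(w)+1}, …, b_n)` with `q(w)` initial copies
of `w`, for some `w ∈ [k]`, and `b_j ≤ min {(j-1) r, w - 1 + rn - k}` for `q(w) + 1 ≤ j ≤ n`.
Here `b_j` is `b i` with `j = i + 1`. -/
def IsDualForm (r k n : ℕ) (b : Fin n → ℤ) : Prop :=
  ∃ w : ℕ, 1 ≤ w ∧ w ≤ k ∧
    (∀ i : Fin n, (i : ℕ) + 1 ≤ qmin r w → b i = w) ∧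
    (∀ i : Fin n, qmin r w + 1 ≤ (i : ℕ) + 1 → b i ≤ dualBound r k n w (i + 1))

/-- `S_n^{(r,k)}`: the `n`-tuples whose increasing rearrangement has the above form. -/
def dualSet (r k n : ℕ) : SubMulAction (Perm (Fin n)) (Fin n → ℤ) where
  carrier := {a | IsDualForm r k n (incr a)}
  smul_mem' σ a ha := by
    change IsDualForm r k n (incr (σ • a))
    rw [incr_smul]; exact ha

end ParkingDual

/-! Let H be the generating series of the complete homogeneous symmetric functions. The
characteristic of all n-tuples over m letters is [t^n] H^m, because splitting the alphabet splits
each invariant colouring (`tupleSym_add`). Everything is reduced to such coefficients.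

Parking side: modulo m = rn + 1, every residue tuple has exactly one translate that is a parking
function, so (rn + 1) F_n = [t^n] H^(rn+1) (`mul_parkingSym`).

Dual side: put m = rn - k. An element of S_n is v + c, with v its least entry and c a tuple of
residues modulo m. By the cycle lemma (`sum_card_le_partial_sums`) each c admits exactly k pairs (u,
v) for which v + (c - u) lies in S_n, so m times the characteristic of S_n is k [t^n] H^m
(`mul_frobeniusChar_dualSet`). Both counts respect permutation of coordinates, hence hold for the
fixed points of each permutation.

Lagrange inversion links the two: the formula for F_n says P(t/H^r) = H, so P^(-k) becomes H^(-k)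
under the same substitution, and reading off coefficients gives (rn - k) G_n = k [t^n] H^(rn-k)
(`coeff_inv_pow_of_coeff`). Cancelling rn - k finishes the proof. -/

namespace ParkingDual

/-! ### Lagrange inversion for formal power series -/

section Lagrange

open PowerSeries

variable {R : Type*} [CommRing R]

theorem eq_of_natCast_mul_eq [Algebra ℚ R] {n : ℕ} (hn : n ≠ 0) {a b : R}
    (h : (n : R) * a = n * b) : a = b := by
  have key : ∀ c : R, ((n : ℚ)⁻¹) • ((n : R) * c) = c := fun c => by
    rw [← nsmul_eq_mul, ← Nat.cast_smul_eq_nsmul ℚ, smul_smul,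
      inv_mul_cancel₀ (Nat.cast_ne_zero.2 hn), one_smul]
  rw [← key a, h, key]

/-- With y = Xψ = X/φ, this coefficient is the residue of y^(-d-1) dy: logarithmic for d = 0, exact
otherwise. -/
theorem coeff_pow_mul_derivative_mul_pow [Algebra ℚ R] (φ ψ : R⟦X⟧) (h : φ * ψ = 1) (j d : ℕ) :
    coeff (j + d) ((X * ψ) ^ j * derivative R (X * ψ) * φ ^ (j + d + 1)) =
      if d = 0 then 1 else 0 := by
  have hd : derivative R ψ * φ + ψ * derivative R φ = 0 := by
    have := congrArg (derivative R) h
    simp only [Derivation.leibniz, smul_eq_mul, Derivation.map_one_eq_zero] at this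
    linear_combination this
  have e1 : (X * ψ) ^ j * derivative R (X * ψ) * φ ^ (j + d + 1) =
      X ^ j * (φ ^ d + X * derivative R ψ * φ ^ (d + 1)) := by
    simp only [Derivation.leibniz, smul_eq_mul, derivative_X]
    have hj : ψ ^ j * φ ^ j = 1 := by rw [← mul_pow, mul_comm, h, one_pow]
    calc _ = (ψ ^ j * φ ^ j) * (φ * ψ) * X ^ j * φ ^ d
          + (ψ ^ j * φ ^ j) * X ^ j * X * derivative R ψ * φ ^ (d + 1) := by ring
      _ = _ := by rw [hj, h]; ring
  rw [e1, add_comm j d, coeff_X_pow_mul]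
  rcases d with _ | d
  · simp [mul_assoc]
  -- ψ = 1/φ turns the second term into -Xφ^dφ', and φ^dφ' is the derivative of φ^(d+1) up to the
  -- factor d + 1; the two contributions cancel.
  · have e2 : X * derivative R ψ * φ ^ (d + 1 + 1) = -(X * (φ ^ d * derivative R φ)) := by
      linear_combination X * φ ^ (d + 1) * hd - X * φ ^ d * derivative R φ * h
    have e3 : derivative R (φ ^ (d + 1)) = C ((d + 1 : ℕ) : R) * (φ ^ d * derivative R φ) := by
      rw [derivative_pow]; simp [mul_assoc]
    have e4 := congrArg (coeff d) e3
    rw [coeff_derivative, coeff_C_mul] at e4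
    rw [e2, if_neg (Nat.succ_ne_zero d), map_add, map_neg, coeff_succ_X_mul]
    refine eq_of_natCast_mul_eq (Nat.succ_ne_zero d) ?_
    push_cast at e4 ⊢
    linear_combination e4

/-- Change of variables in a residue. The part of D of order above n contributes nothing, so
linearity leaves finitely many monomials, and only degree n survives. -/
theorem coeff_subst_mul_derivative_mul_pow [Algebra ℚ R] (φ ψ : R⟦X⟧) (h : φ * ψ = 1)
    (D : R⟦X⟧) (n : ℕ) :
    coeff n (D.subst (X * ψ) * derivative R (X * ψ) * φ ^ (n + 1)) = coeff n D := by
  have hs : HasSubst (X * ψ) := HasSubst.of_constantCoeff_zero' (by simp)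
  have hD := eq_X_pow_mul_shift_add_trunc (n + 1) D
  set E : R⟦X⟧ := PowerSeries.mk fun i => coeff (i + (n + 1)) D
  have hsub : D.subst (X * ψ) = (X * ψ) ^ (n + 1) * E.subst (X * ψ) +
      ∑ i ∈ Finset.range (n + 1), C (coeff i D) * (X * ψ) ^ i := by
    conv_lhs => rw [hD]
    rw [subst_add hs, subst_mul hs, subst_pow hs, subst_X hs, subst_coe hs,
      Polynomial.aeval_eq_sum_range' (n := n + 1) (natDegree_trunc_lt D n)]
    congr 1
    refine Finset.sum_congr rfl fun i hi => ?_
    rw [coeff_trunc, if_pos (Finset.mem_range.1 hi), smul_eq_C_mul]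
  rw [hsub, add_mul, add_mul, map_add, Finset.sum_mul, Finset.sum_mul, map_sum]
  have hz : coeff n ((X * ψ) ^ (n + 1) * E.subst (X * ψ) * derivative R (X * ψ) * φ ^ (n + 1))
      = 0 := by
    rw [mul_pow, mul_assoc, mul_assoc, mul_assoc, coeff_X_pow_mul', if_neg (by omega)]
  rw [hz, zero_add, Finset.sum_eq_single n]
  · have := coeff_pow_mul_derivative_mul_pow φ ψ h n 0
    simp only [add_zero, if_true] at this
    rw [mul_assoc, mul_assoc, coeff_C_mul, ← mul_assoc, this, mul_one]
  · intro i hi hin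
    obtain ⟨d, rfl⟩ := Nat.exists_eq_add_of_le (Nat.lt_succ_iff.1 (Finset.mem_range.1 hi))
    have := coeff_pow_mul_derivative_mul_pow φ ψ h i d
    rw [if_neg (by omega)] at this
    rw [mul_assoc, mul_assoc, coeff_C_mul, ← mul_assoc, this, mul_zero]
  · intro h'; simp at h'

/-- Lagrange inversion, in the form: the coefficients of `f` are read off from `f(z / φ(z))`. -/
theorem coeff_derivative_subst_mul_pow [Algebra ℚ R] (φ ψ : R⟦X⟧) (h : φ * ψ = 1)
    (f : R⟦X⟧) (n : ℕ) :
    coeff n (derivative R (f.subst (X * ψ)) * φ ^ (n + 1)) = (n + 1 : ℕ) * coeff (n + 1) f := by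
  have hs : HasSubst (X * ψ) := HasSubst.of_constantCoeff_zero' (by simp)
  rw [derivative_subst hs, coeff_subst_mul_derivative_mul_pow φ ψ h, coeff_derivative]
  push_cast; ring

/-- The conditions are triangular: the n-th is (n + 1) times coefficient n + 1 of f, plus terms in
earlier coefficients. -/
theorem eq_zero_of_coeff_derivative_mul_pow [Algebra ℚ R] (φ f : R⟦X⟧)
    (hφ : constantCoeff φ = 1) (h0 : constantCoeff f = 0)
    (hf : ∀ n, coeff n (derivative R f * φ ^ (n + 1)) = 0) : f = 0 := by
  ext n
  induction n using Nat.strong_induction_on with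
  | _ n ih =>
    rcases n with _ | n
    · simpa using h0
    · have h := hf n
      rw [coeff_mul, Finset.sum_eq_single (n, 0)] at h
      · refine eq_of_natCast_mul_eq (Nat.succ_ne_zero n) ?_
        rw [coeff_derivative] at h
        simp only [coeff_zero_eq_constantCoeff, map_pow, hφ, one_pow, mul_one] at h
        push_cast
        rw [mul_comm, h]; simp
      · rintro ⟨i, j⟩ hij hne
        have hij' : i + j = n := by simpa using hij
        have hi : i < n := by
          rcases Nat.eq_zero_or_pos j with rfl | hj
          · exact absurd (by simp_all) hne
          · omega
        rw [coeff_derivative, ih (i + 1) (by omega)]; simp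
      · intro h'; simp at h'

/-- Both series have the same Lagrange data: with N = n + 1, H' H^(rN) is the derivative of H^(rN+1)
divided by rN + 1. -/
theorem subst_eq_of_coeff [Algebra ℚ R] (H ψ P : R⟦X⟧) (r : ℕ) (hH : constantCoeff H = 1)
    (hψ : H ^ r * ψ = 1) (hP0 : constantCoeff P = 1)
    (hP : ∀ n, ((r * n + 1 : ℕ) : R) * coeff n P = coeff n (H ^ (r * n + 1))) :
    P.subst (X * ψ) = H := by
  have hs : HasSubst (X * ψ) := HasSubst.of_constantCoeff_zero' (by simp)
  rw [← sub_eq_zero]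
  refine eq_zero_of_coeff_derivative_mul_pow (H ^ r) _ (by simp [hH]) ?_ fun n => ?_
  · have : P = C 1 + (P - C 1) := by ring
    rw [map_sub, hH, this, subst_add hs, subst_C, map_add]
    have h1 : constantCoeff ((P - C 1).subst (X * ψ)) = 0 :=
      constantCoeff_subst_eq_zero (by simp [← PowerSeries.constantCoeff.eq_def]) _ (by simp [hP0])
    have h2 : constantCoeff (MvPowerSeries.C (1 : R) : R⟦X⟧) = 1 :=
      constantCoeff_C (1 : R)
    rw [h1, h2]; ring
  · rw [map_sub, sub_mul, map_sub, coeff_derivative_subst_mul_pow _ _ hψ, sub_eq_zero]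
    refine eq_of_natCast_mul_eq (n := r * (n + 1) + 1) (Nat.succ_ne_zero _) ?_
    have e : derivative R (H ^ (r * (n + 1) + 1)) =
        C ((r * (n + 1) + 1 : ℕ) : R) * (derivative R H * (H ^ r) ^ (n + 1)) := by
      rw [derivative_pow, ← pow_mul, Nat.add_sub_cancel, map_natCast]; ring
    have e' := congrArg (coeff n) e
    rw [coeff_derivative, coeff_C_mul, ← hP] at e'
    push_cast at e' ⊢
    linear_combination e'

/-- If `P = ∑ p_n t^n` with `(rn + 1) p_n = [t^n] H^{rn+1}`, then the coefficients of `P^{-k}` are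
`-k / (rn - k) [t^n] H^{rn-k}`. -/
theorem coeff_inv_pow_of_coeff [Algebra ℚ R] (H P Q : R⟦X⟧) (r k : ℕ)
    (hH : constantCoeff H = 1) (hP0 : constantCoeff P = 1)
    (hP : ∀ n, ((r * n + 1 : ℕ) : R) * coeff n P = coeff n (H ^ (r * n + 1)))
    (hQ : P ^ k * Q = 1) (n m : ℕ) (hn : n ≠ 0) (hm : m ≠ 0) (hnm : r * n = k + m) :
    (m : R) * -coeff n Q = k * coeff n (H ^ m) := by
  obtain ⟨ψ, hψ⟩ : ∃ ψ, H ^ r * ψ = 1 :=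
    ⟨invOfUnit (H ^ r) 1, mul_invOfUnit _ _ (by simp [hH])⟩
  have hs : HasSubst (X * ψ) := HasSubst.of_constantCoeff_zero' (by simp)
  have hPH := subst_eq_of_coeff H ψ P r hH hψ hP0 hP
  set V := Q.subst (X * ψ) with hV
  have hHV : H ^ k * V = 1 := by
    have := congrArg (PowerSeries.subst (X * ψ)) hQ
    rw [subst_mul hs, subst_pow hs, hPH] at this
    rw [this, ← coe_substAlgHom hs, map_one]
  obtain ⟨n, rfl⟩ := Nat.exists_eq_succ_of_ne_zero hn
  obtain ⟨m, rfl⟩ := Nat.exists_eq_succ_of_ne_zero hm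
  have hL := coeff_derivative_subst_mul_pow _ _ hψ Q n
  rw [← hV, ← pow_mul, hnm] at hL
  have hdV : derivative R V * H ^ k + V * derivative R (H ^ k) = 0 := by
    have := congrArg (derivative R) hHV
    simp only [Derivation.leibniz, smul_eq_mul, Derivation.map_one_eq_zero] at this
    linear_combination this
  have hdk : derivative R (H ^ k) * H = C (k : R) * H ^ k * derivative R H := by
    rcases k with _ | k
    · simp
    · rw [derivative_pow, map_natCast]; simp only [Nat.add_sub_cancel]; ring
  have hdm : derivative R (H ^ (m + 1)) = C ((m + 1 : ℕ) : R) * (H ^ m * derivative R H) := by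
    rw [derivative_pow, map_natCast]; simp only [Nat.add_sub_cancel]; ring
  -- As V is H^(-k), both sides equal -k(m + 1) H^m H'.
  have key : C ((m + 1 : ℕ) : R) * (derivative R V * H ^ (k + (m + 1))) =
      - (C (k : R) * derivative R (H ^ (m + 1))) := by
    rw [hdm]
    linear_combination C ((m + 1 : ℕ) : R) * H ^ (m + 1) * hdV
      - C ((m + 1 : ℕ) : R) * H ^ m * V * hdk
      - C ((m + 1 : ℕ) : R) * H ^ m * C (k : R) * derivative R H * hHV
  have key' := congrArg (coeff n) key
  rw [coeff_C_mul, hL, map_neg, coeff_C_mul, coeff_derivative] at key'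
  refine eq_of_natCast_mul_eq (Nat.succ_ne_zero n) ?_
  push_cast at key' ⊢
  linear_combination -key'

end Lagrange
end ParkingDual

namespace ParkingDual
open Equiv

/-! ### Cycle index sums and powers of the homogeneous series -/

section CycleIndex

/-- The power sum indexed by the cycle type of a permutation. -/
noncomputable def cycleWeight {α : Type} [Fintype α] [DecidableEq α] (w : Perm α) : SymRing :=
  powerSumPart w.partition

variable {α β γ : Type} [Fintype α] [DecidableEq α]

theorem cycleWeight_eq (w : Perm α) : cycleWeight w =
    (w.cycleType.map powerSum).prod * powerSum 1 ^ (Fintype.card α - w.support.card) := by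
  simp [cycleWeight, powerSumPart, Perm.parts_partition]

theorem cycleWeight_permCongr {α' : Type} [Fintype α'] [DecidableEq α'] (e : α ≃ α')
    (w : Perm α) : cycleWeight (e.permCongr w) = cycleWeight w := by
  have h : (e.permCongr w).cycleType = w.cycleType := by
    -- A trivially true predicate presents transport along `e` as an `extendDomain`, which preserves
    -- cycle types.
    let f : α ≃ {x : α' // True} := e.trans (Equiv.subtypeUnivEquiv fun _ => trivial).symm
    rw [← Perm.cycleType_extendDomain f]
    congr 1
  rw [cycleWeight_eq, cycleWeight_eq, ← Perm.sum_cycleType, ← Perm.sum_cycleType, h,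
    Fintype.card_congr e]

theorem cycleWeight_subtypeCongr (p : α → Prop) [DecidablePred p]
    [Fintype {x // p x}] [Fintype {x // ¬ p x}] (w₁ : Perm {x // p x})
    (w₂ : Perm {x // ¬ p x}) :
    cycleWeight (w₁.subtypeCongr w₂) = cycleWeight w₁ * cycleWeight w₂ := by
  have e : w₁.subtypeCongr w₂ = Perm.ofSubtype w₁ * Perm.ofSubtype w₂ := by
    ext x
    by_cases hx : p x
    · rw [Perm.subtypeCongr.left_apply _ _ hx, Perm.mul_apply,
        Perm.ofSubtype_apply_of_not_mem w₂ (by simpa using hx), Perm.ofSubtype_apply_of_mem w₁ hx]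
    · rw [Perm.subtypeCongr.right_apply _ _ hx, Perm.mul_apply,
        Perm.ofSubtype_apply_of_mem w₂ hx, Perm.ofSubtype_apply_of_not_mem w₁ (w₂ ⟨x, hx⟩).2]
  have hd : Perm.Disjoint (Perm.ofSubtype w₁) (Perm.ofSubtype w₂) := by
    intro x
    by_cases hx : p x
    · exact Or.inr (Perm.ofSubtype_apply_of_not_mem w₂ (by simpa using hx))
    · exact Or.inl (Perm.ofSubtype_apply_of_not_mem w₁ hx)
  have hc : Fintype.card α = Fintype.card {x // p x} + Fintype.card {x // ¬ p x} := by
    rw [← Fintype.card_sum]; exact Fintype.card_congr (Equiv.sumCompl p).symm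
  have h1 := w₁.support.card_le_univ
  have h2 := w₂.support.card_le_univ
  have hct : (w₁.subtypeCongr w₂).cycleType = w₁.cycleType + w₂.cycleType := by
    rw [e, hd.cycleType_mul, Perm.cycleType_ofSubtype, Perm.cycleType_ofSubtype]
  have hs : (w₁.subtypeCongr w₂).support.card = w₁.support.card + w₂.support.card := by
    rw [← Perm.sum_cycleType, hct, Multiset.sum_add, Perm.sum_cycleType, Perm.sum_cycleType]
  rw [cycleWeight_eq, cycleWeight_eq, cycleWeight_eq, hs, hct, Multiset.map_add,
    Multiset.prod_add, hc, show ∀ a b c d : ℕ, c ≤ a → d ≤ b → a + b - (c + d) = (a - c) + (b - d)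
      by omega, pow_add]
  · ring
  · exact h1
  · exact h2

/-- A permutation together with a colouring that it preserves. -/
@[ext]
structure InvColouring (α β : Type) where
  perm : Perm α
  col : α → β
  col_perm : ∀ i, col (perm i) = col i

/-- Invariant colourings, grouped by the permutation. -/
def invColouringEquiv (α β : Type) :
    InvColouring α β ≃ Σ w : Perm α, {c : α → β // ∀ i, c (w i) = c i} where
  toFun x := ⟨x.perm, x.col, x.col_perm⟩
  invFun x := ⟨x.1, x.2.1, x.2.2⟩
  left_inv _ := rfl
  right_inv _ := rfl

noncomputable instance [Fintype β] : Fintype (InvColouring α β) :=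
  have : Finite (InvColouring α β) := Finite.of_equiv _ (invColouringEquiv α β).symm
  Fintype.ofFinite _

/-- The cycle-index sum over all permutations of `α` with invariant colourings in `β`. -/
noncomputable def colourSum (α β : Type) [Fintype α] [DecidableEq α] [Fintype β] : SymRing :=
  ∑ x : InvColouring α β, cycleWeight x.perm

theorem colourSum_congr {α' : Type} [Fintype α'] [DecidableEq α'] [Fintype β]
    (e : α ≃ α') : colourSum α β = colourSum α' β := by
  let f : InvColouring α β ≃ InvColouring α' β :=
    { toFun := fun x => ⟨e.permCongr x.perm, x.col ∘ e.symm, fun i => by simp [x.col_perm]⟩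
      invFun := fun x => ⟨e.symm.permCongr x.perm, x.col ∘ e, fun i => by simp [x.col_perm]⟩
      left_inv := fun x => by ext <;> simp
      right_inv := fun x => by ext <;> simp }
  exact Fintype.sum_equiv f _ _ fun x => (cycleWeight_permCongr e x.perm).symm

theorem colourSum_congr_right {β' : Type} [Fintype β] [Fintype β']
    (e : β ≃ β') : colourSum α β = colourSum α β' := by
  let f : InvColouring α β ≃ InvColouring α β' :=
    { toFun := fun x => ⟨x.perm, e ∘ x.col, fun i => by simp [x.col_perm]⟩
      invFun := fun x => ⟨x.perm, e.symm ∘ x.col, fun i => by simp [x.col_perm]⟩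
      left_inv := fun x => by ext <;> simp
      right_inv := fun x => by ext <;> simp }
  exact Fintype.sum_equiv f _ _ fun x => rfl

/-- Glue invariant colourings of a set and of its complement. -/
def glueColouring (x : Σ S : Finset α, InvColouring {i // i ∈ S} β × InvColouring {i // i ∉ S} γ) :
    InvColouring α (β ⊕ γ) where
  perm := x.2.1.perm.subtypeCongr x.2.2.perm
  col i := if h : i ∈ x.1 then Sum.inl (x.2.1.col ⟨i, h⟩) else Sum.inr (x.2.2.col ⟨i, h⟩)
  col_perm i := by
    by_cases hi : i ∈ x.1
    · have := (x.2.1.perm ⟨i, hi⟩).2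
      simp only [Perm.subtypeCongr.left_apply _ _ hi, this, hi, dif_pos, Subtype.coe_eta]
      rw [x.2.1.col_perm]
    · have := (x.2.2.perm ⟨i, hi⟩).2
      simp only [Perm.subtypeCongr.right_apply _ _ hi, this, hi, dif_neg, Subtype.coe_eta,
        not_false_eq_true]
      rw [x.2.2.col_perm]

theorem glueColouring_injective {α β γ : Type} [DecidableEq α] :
    Function.Injective (glueColouring (α := α) (β := β) (γ := γ)) := by
  rintro ⟨S, ⟨w₁, c₁, h₁⟩, ⟨w₂, c₂, h₂⟩⟩ ⟨T, ⟨v₁, d₁, k₁⟩, ⟨v₂, d₂, k₂⟩⟩ h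
  simp only [glueColouring, InvColouring.mk.injEq] at h
  obtain ⟨hw, hc⟩ := h
  have hST : S = T := by
    ext i
    have := congrFun hc i
    by_cases hS : i ∈ S <;> by_cases hT : i ∈ T <;> simp_all
  subst hST
  obtain ⟨rfl, rfl⟩ : w₁ = v₁ ∧ w₂ = v₂ := by
    constructor
    · ext ⟨i, hi⟩
      have := Perm.congr_fun hw i
      rwa [Perm.subtypeCongr.left_apply _ _ hi, Perm.subtypeCongr.left_apply _ _ hi] at this
    · ext ⟨i, hi⟩
      have := Perm.congr_fun hw i
      rwa [Perm.subtypeCongr.right_apply _ _ hi, Perm.subtypeCongr.right_apply _ _ hi] at this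
  obtain rfl : c₁ = d₁ := by
    ext ⟨i, hi⟩
    simpa [hi] using congrFun hc i
  obtain rfl : c₂ = d₂ := by
    ext ⟨i, hi⟩
    simpa [hi] using congrFun hc i
  rfl

theorem glueColouring_surjective :
    Function.Surjective (glueColouring (α := α) (β := β) (γ := γ)) := by
  classical
  rintro ⟨w, c, h⟩
  let S : Finset α := Finset.univ.filter fun i => (c i).isLeft
  have hS : ∀ i, i ∈ S ↔ (c i).isLeft := by simp [S]
  have hS' : ∀ i, i ∉ S ↔ (c i).isRight := by simp [S]
  have hw : ∀ i, w i ∈ S ↔ i ∈ S := fun i => by rw [hS, hS, h]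
  refine ⟨⟨S, ⟨w.subtypePerm hw, fun i => (c i).getLeft ((hS _).1 i.2), fun i => by simp [h]⟩,
    ⟨w.subtypePerm fun i => not_congr (hw i), fun i => (c i).getRight ((hS' _).1 i.2),
      fun i => by simp [h]⟩⟩, ?_⟩
  refine InvColouring.ext ?_ ?_
  · ext i
    by_cases hi : i ∈ S
    · simp [glueColouring, Perm.subtypeCongr.left_apply _ _ hi]
    · simp [glueColouring, Perm.subtypeCongr.right_apply _ _ hi]
  · funext i
    by_cases hi : i ∈ S
    · simp [glueColouring]
    · simp [glueColouring]

/-- Invariance makes the set of positions coloured by β a union of cycles, so the permutation splits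
along it and the cycle weights multiply. -/
theorem colourSum_sum [Fintype β] [Fintype γ] : colourSum α (β ⊕ γ) =
    ∑ S : Finset α, colourSum {i // i ∈ S} β * colourSum {i // i ∉ S} γ := by
  have h := Fintype.sum_bijective (glueColouring (α := α) (β := β) (γ := γ))
    ⟨glueColouring_injective, glueColouring_surjective⟩
    (fun x => cycleWeight x.2.1.perm * cycleWeight x.2.2.perm) (fun x => cycleWeight x.perm)
    (fun x => (cycleWeight_subtypeCongr _ _ _).symm)
  rw [colourSum, ← h, Fintype.sum_sigma]
  refine Finset.sum_congr rfl fun S _ => ?_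
  rw [colourSum, colourSum, Finset.sum_mul_sum, Fintype.sum_prod_type]

/-- `(1/n!) ∑_w m^{c(w)} p_{ρ(w)}`, the Frobenius characteristic of `𝔖_n` on `β^n`, `|β| = m`. -/
noncomputable def tupleSym (m n : ℕ) : SymRing :=
  ((n.factorial : ℚ)⁻¹) • colourSum (Fin n) (Fin m)

theorem colourSum_eq_tupleSym [Fintype β] :
    colourSum α β = ((Fintype.card α).factorial : ℚ) • tupleSym (Fintype.card β) (Fintype.card α) := by
  rw [tupleSym, smul_smul, mul_inv_cancel₀ (Nat.cast_ne_zero.2 (Nat.factorial_ne_zero _)),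
    one_smul, colourSum_congr (Fintype.equivFin α), colourSum_congr_right (Fintype.equivFin β)]

theorem tupleSym_add (m m' n : ℕ) : tupleSym (m + m') n =
    ∑ x ∈ Finset.HasAntidiagonal.antidiagonal n, tupleSym m x.1 * tupleSym m' x.2 := by
  rw [tupleSym, colourSum_congr_right finSumFinEquiv.symm, colourSum_sum]
  simp only [colourSum_eq_tupleSym, Fintype.card_coe, Fintype.card_fin]
  have hc : ∀ S : Finset (Fin n), Fintype.card {i // i ∉ S} = n - S.card := fun S => by
    rw [Fintype.card_subtype_compl, Fintype.card_coe, Fintype.card_fin]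
  simp only [hc]
  rw [← Finset.powerset_univ, Finset.sum_powerset_apply_card (x := (Finset.univ : Finset (Fin n)))
    (fun i => ((i.factorial : ℚ) • tupleSym m i) *
      (((n - i).factorial : ℚ) • tupleSym m' (n - i))), Finset.card_univ, Fintype.card_fin,
    Finset.Nat.sum_antidiagonal_eq_sum_range_succ (fun i j => tupleSym m i * tupleSym m' j),
    Finset.smul_sum]
  refine Finset.sum_congr rfl fun i hi => ?_
  have hi' : i ≤ n := Nat.lt_succ_iff.1 (Finset.mem_range.1 hi)
  rw [smul_mul_smul_comm, ← Nat.cast_smul_eq_nsmul ℚ, smul_smul, smul_smul]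
  have := Nat.choose_mul_factorial_mul_factorial hi'
  have h2 : (n.factorial : ℚ)⁻¹ * (n.choose i * (i.factorial * (n - i).factorial)) = 1 := by
    rw [inv_mul_eq_one₀ (Nat.cast_ne_zero.2 (Nat.factorial_ne_zero _)), ← this]
    push_cast; ring
  rw [mul_assoc, h2, one_smul]

theorem tupleSym_zero_right (m : ℕ) : tupleSym m 0 = 1 := by
  have h : ∀ w : Perm (Fin 0), cycleWeight w = 1 := fun w => by
    rw [cycleWeight_eq, Subsingleton.elim w 1]; simp
  have hc : Fintype.card (InvColouring (Fin 0) (Fin m)) = 1 := by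
    rw [Fintype.card_eq_one_iff]
    exact ⟨⟨1, Fin.elim0, fun i => i.elim0⟩, fun x => by ext i <;> exact i.elim0⟩
  simp [tupleSym, colourSum, h, hc]

theorem tupleSym_zero_left {n : ℕ} (hn : n ≠ 0) : tupleSym 0 n = 0 := by
  have : IsEmpty (InvColouring (Fin n) (Fin 0)) :=
    ⟨fun x => (x.col ⟨0, Nat.pos_of_ne_zero hn⟩).elim0⟩
  simp [tupleSym, colourSum]

/-- The generating series of the complete homogeneous symmetric functions. -/
noncomputable def homSeries : PowerSeries SymRing := PowerSeries.mk (tupleSym 1)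

theorem constantCoeff_homSeries : PowerSeries.constantCoeff homSeries = 1 := by
  rw [← PowerSeries.coeff_zero_eq_constantCoeff_apply, homSeries, PowerSeries.coeff_mk,
    tupleSym_zero_right]

theorem coeff_homSeries_pow (m n : ℕ) : PowerSeries.coeff n (homSeries ^ m) = tupleSym m n := by
  suffices h : homSeries ^ m = PowerSeries.mk (tupleSym m) by rw [h, PowerSeries.coeff_mk]
  induction m with
  | zero =>
    ext1 n
    rw [pow_zero, PowerSeries.coeff_one, PowerSeries.coeff_mk]
    split_ifs with hn
    · rw [hn, tupleSym_zero_right]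
    · rw [tupleSym_zero_left hn]
  | succ m ih =>
    ext1 n
    rw [pow_succ, ih, PowerSeries.coeff_mul, PowerSeries.coeff_mk, tupleSym_add]
    simp [homSeries]

/-- Proportional fixed point counts give proportional Frobenius characteristics. -/
theorem natCast_mul_frobeniusChar {n m k : ℕ} (C : Type) [MulAction (Perm (Fin n)) C]
    [Fintype β] (h : ∀ w : Perm (Fin n), m * Nat.card (MulAction.fixedBy C w) =
      k * Nat.card {c : Fin n → β // ∀ i, c (w i) = c i}) :
    (m : SymRing) * frobeniusChar n C = k * tupleSym (Fintype.card β) n := by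
  have e : colourSum (Fin n) β = ∑ w : Perm (Fin n),
      (Nat.card {c : Fin n → β // ∀ i, c (w i) = c i} : ℚ) • cycleWeight w := by
    classical
    have : ∀ w : Perm (Fin n), Fintype {c : Fin n → β // ∀ i, c (w i) = c i} :=
      fun w => Fintype.ofFinite _
    rw [colourSum, Fintype.sum_equiv (invColouringEquiv (Fin n) β) (fun x => cycleWeight x.perm)
      (fun x => cycleWeight x.1) (fun _ => rfl),
      Fintype.sum_sigma]
    refine Finset.sum_congr rfl fun w _ => ?_
    change ∑ _y : {c : Fin n → β // ∀ i, c (w i) = c i}, cycleWeight w = _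
    rw [Finset.sum_const, Finset.card_univ, Nat.card_eq_fintype_card, Nat.cast_smul_eq_nsmul]
  have e' : tupleSym (Fintype.card β) n = ((n.factorial : ℚ)⁻¹) • colourSum (Fin n) β := by
    rw [tupleSym, colourSum_congr_right (Fintype.equivFin β)]
  rw [e', e, frobeniusChar, ← nsmul_eq_mul, ← nsmul_eq_mul, smul_comm m, smul_comm k]
  congr 1
  rw [Finset.smul_sum, Finset.smul_sum]
  refine Finset.sum_congr rfl fun w _ => ?_
  rw [← Nat.cast_smul_eq_nsmul ℚ, ← Nat.cast_smul_eq_nsmul ℚ, smul_smul, smul_smul,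
    ← Nat.cast_mul, ← Nat.cast_mul, h w]
  rfl

end CycleIndex
end ParkingDual

namespace ParkingDual
open Equiv

/-! ### The cycle lemma and translates of residue tuples -/

section CycleLemma

variable {m : ℕ} [NeZero m]

theorem sum_zmod_eq_sum_range {M : Type*} [AddCommMonoid M] (f : ZMod m → M) :
    ∑ u, f u = ∑ t ∈ Finset.range m, f (t : ZMod m) := by
  refine Finset.sum_nbij' (fun u => u.val) (fun t => (t : ZMod m)) ?_ ?_ ?_ ?_ ?_
  · intro u _; simpa using ZMod.val_lt u
  · intro t _; simp
  · intro u _; simp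
  · intro t ht; exact ZMod.val_cast_of_lt (Finset.mem_range.1 ht)
  · intro u _; simp

/-- The walk with steps `x` around the cycle, started at `u`, stays at height at least `v`. -/
def WalkGe (x : ZMod m → ℤ) (u : ZMod m) (v : ℕ) : Prop :=
  ∀ i ∈ Finset.Icc 1 m, (v : ℤ) ≤ ∑ j ∈ Finset.range i, x (u + j)

open Classical in
/-- The cycle lemma, in the form: around a cycle of integer steps with total `K ≥ 0`, the positive
parts of the minima of the walks that start at the various points add up to `K`. -/
theorem sum_card_le_partial_sums (x : ZMod m → ℤ) (K : ℕ) (hx : ∑ t, x t = K) :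
    ∑ u : ZMod m, ((Finset.Icc 1 K).filter fun v => WalkGe x u v).card = K := by
  have hm : 1 ≤ m := Nat.one_le_iff_ne_zero.2 (NeZero.ne m)
  set X : ℕ → ℤ := fun t => ∑ s ∈ Finset.range t, x (s : ZMod m) with hX
  have hXadd : ∀ t i : ℕ, ∑ j ∈ Finset.range i, x ((t : ZMod m) + j) = X (t + i) - X t := by
    intro t i
    simp only [hX, Finset.sum_range_add]
    push_cast; ring
  have hper : ∀ t, X (t + m) = X t + K := by
    intro t
    have h1 := hXadd t m
    have h2 : ∑ j ∈ Finset.range m, x ((t : ZMod m) + j) = K := by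
      rw [← sum_zmod_eq_sum_range (fun u => x ((t : ZMod m) + u)), ← hx]
      exact Fintype.sum_equiv (Equiv.addLeft (t : ZMod m)) _ _ fun _ => rfl
    omega
  have hne : (Finset.Icc 1 m).Nonempty := ⟨1, by simpa using hm⟩
  set M : ℕ → ℤ := fun t => (Finset.Icc 1 m).inf' hne fun i => X (t + i) with hM
  have hle : ∀ t a, a ≤ M t ↔ ∀ i ∈ Finset.Icc 1 m, a ≤ X (t + i) := fun t a => by
    rw [hM, Finset.le_inf'_iff]
  have hMle : ∀ t i, 1 ≤ i → i ≤ m → M t ≤ X (t + i) := fun t i h1 h2 =>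
    (hle t _).1 le_rfl i (Finset.mem_Icc.2 ⟨h1, h2⟩)
  -- Consecutive windows differ only in X (t + 1) and X (t + 1 + m), and the latter is larger by K ≥
  -- 0.
  have hstep : ∀ t, M t = min (X (t + 1)) (M (t + 1)) := by
    intro t
    apply le_antisymm
    · refine le_min (hMle t 1 le_rfl hm) ((hle _ _).2 fun i hi => ?_)
      rw [Finset.mem_Icc] at hi
      rcases hi.2.lt_or_eq with h | rfl
      · have := hMle t (i + 1) (by omega) h
        rwa [add_assoc, add_comm 1 i]
      · have := hMle t 1 le_rfl hm
        rw [hper]; omega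
    · refine (hle _ _).2 fun i hi => ?_
      rw [Finset.mem_Icc] at hi
      rcases hi.1.lt_or_eq with h | rfl
      · have := hMle (t + 1) (i - 1) (by omega) (by omega)
        rw [show t + 1 + (i - 1) = t + i by omega] at this
        exact (min_le_right _ _).trans this
      · exact min_le_left _ _
  -- The count is the positive part of M (t + 1) - X (t + 1); the cap K is harmless since a full
  -- turn ends at height K. The recursion for M makes it a telescoping difference.
  have hcard : ∀ t : ℕ, (((Finset.Icc 1 K).filter fun v =>
      WalkGe x ((t + 1 : ℕ) : ZMod m) v).card : ℤ) =
      M (t + 1) - M t := by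
    intro t
    have h1 : ((Finset.Icc 1 K).filter fun v => WalkGe x ((t + 1 : ℕ) : ZMod m) v) =
        Finset.Icc 1 (M (t + 1) - X (t + 1)).toNat := by
      ext v
      have hK := hMle (t + 1) m hm le_rfl
      rw [hper] at hK
      have : WalkGe x ((t + 1 : ℕ) : ZMod m) v ↔
          (v : ℤ) + X (t + 1) ≤ M (t + 1) := by
        rw [hle, WalkGe]
        refine forall₂_congr fun i _ => ?_
        rw [hXadd, le_sub_iff_add_le]
      rw [Finset.mem_filter, this, Finset.mem_Icc, Finset.mem_Icc]
      omega
    have := hstep t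
    rw [h1, Nat.card_Icc]
    omega
  have hsum : ∑ u : ZMod m, (((Finset.Icc 1 K).filter fun v => WalkGe x u v).card : ℤ) = K := by
    rw [← Fintype.sum_equiv (Equiv.addRight (1 : ZMod m)) _ _ (fun _ => rfl),
      sum_zmod_eq_sum_range]
    have : ∀ t : ℕ, Equiv.addRight (1 : ZMod m) (t : ZMod m) = ((t + 1 : ℕ) : ZMod m) := by simp
    simp only [this, hcard]
    rw [Finset.sum_range_sub]
    have h2 : M (0 + m) = M 0 + K := by
      apply le_antisymm
      · rw [← sub_le_iff_le_add, hle]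
        intro i hi
        rw [Finset.mem_Icc] at hi
        have := hMle (0 + m) i hi.1 hi.2
        rw [add_right_comm, hper] at this
        omega
      · rw [hle]
        intro i hi
        rw [Finset.mem_Icc] at hi
        have := hMle 0 i hi.1 hi.2
        rw [add_right_comm, hper]
        omega
    rw [zero_add] at h2
    omega
  exact_mod_cast hsum

variable {n : ℕ}

theorem sum_range_card_fiber (c : Fin n → ZMod m) (u : ZMod m) {i : ℕ} (hi : i ≤ m) :
    ∑ j ∈ Finset.range i, (Finset.univ.filter fun l => c l = u + j).card =
      (Finset.univ.filter fun l => (c l - u).val < i).card := by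
  rw [Finset.card_eq_sum_card_fiberwise (f := fun l => (c l - u).val) (t := Finset.range i)
    (fun l hl => by simpa using hl)]
  refine Finset.sum_congr rfl fun j hj => ?_
  have hj' : j < i := Finset.mem_range.1 hj
  congr 1
  ext l
  have : c l = u + j ↔ (c l - u).val = j := by
    rw [← sub_eq_iff_eq_add']
    constructor
    · intro h; rw [h, ZMod.val_cast_of_lt (hj'.trans_le hi)]
    · intro h; rw [← h]; simp
  simp only [Finset.mem_filter, Finset.mem_univ, true_and, this]
  omega

theorem sum_card_fiber (c : Fin n → ZMod m) :
    ∑ t, (Finset.univ.filter fun l => c l = t).card = n := by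
  rw [← Finset.card_eq_sum_card_fiberwise (fun _ _ => Finset.mem_univ _)]
  simp

/-- The walk of a residue tuple stays at height at least `v`. -/
def DualCond (r : ℕ) (c : Fin n → ZMod m) (v : ℕ) : Prop :=
  ∀ i ∈ Finset.Icc 1 m, v + i ≤ r * (Finset.univ.filter fun l => (c l).val < i).card

/-- The walk of a residue tuple stays nonnegative. -/
def ParkCond (r : ℕ) (c : Fin n → ZMod m) : Prop :=
  ∀ i < m, i ≤ r * (Finset.univ.filter fun l => (c l).val < i).card

-- The step at t is r times the multiplicity of t, minus 1; the total is rn - m = k.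
open Classical in
theorem sum_card_dualCond {r k : ℕ} (h : r * n = k + m) (c : Fin n → ZMod m) :
    ∑ u : ZMod m, ((Finset.Icc 1 k).filter fun v => DualCond r (fun l => c l - u) v).card = k := by
  have hx := sum_card_le_partial_sums
    (fun t : ZMod m => (r : ℤ) * (Finset.univ.filter fun l => c l = t).card - 1) k (by
      rw [Finset.sum_sub_distrib, ← Finset.mul_sum, ← Nat.cast_sum, sum_card_fiber]
      have : (r : ℤ) * n = k + m := by exact_mod_cast h
      simp [this])
  refine Eq.trans (Finset.sum_congr rfl fun u _ => ?_) hx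
  congr 1
  refine Finset.filter_congr fun v _ => forall₂_congr fun i hi => ?_
  rw [Finset.sum_sub_distrib, ← Finset.mul_sum, ← Nat.cast_sum,
    sum_range_card_fiber c u (Finset.mem_Icc.1 hi).2]
  simp only [Finset.sum_const, Finset.card_range, nsmul_eq_mul, mul_one]
  zify
  omega

-- Here the natural walk has total rn - m = -1, so it is reversed and negated by reflecting
-- residues, x ↦ -1 - x. The total becomes 1, and exactly one starting point stays positive.
open Classical in
theorem sum_parkCond {r : ℕ} (h : r * n + 1 = m) (c : Fin n → ZMod m) :
    ∑ u : ZMod m, (if ParkCond r (fun l => c l - u) then 1 else 0) = 1 := by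
  have hx := sum_card_le_partial_sums
    (fun t : ZMod m => 1 - (r : ℤ) * (Finset.univ.filter fun l => -1 - c l = t).card) 1 (by
      rw [Finset.sum_sub_distrib, ← Finset.mul_sum, ← Nat.cast_sum,
        sum_card_fiber (fun l => -1 - c l)]
      have : (r : ℤ) * n + 1 = m := by exact_mod_cast h
      simp; omega)
  rw [← Fintype.sum_equiv (Equiv.neg (ZMod m)) _ _ (fun _ => rfl)]
  refine Eq.trans (Finset.sum_congr rfl fun u _ => ?_) hx
  have hval : ∀ d : ZMod m, (-1 - d).val + d.val = m - 1 := by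
    intro d
    have hd := ZMod.val_lt d
    have e : (-1 - d : ZMod m) = ((m - 1 - d.val : ℕ) : ZMod m) := by
      rw [Nat.cast_sub (by omega), Nat.cast_sub (by omega)]; simp
    rw [e, ZMod.val_cast_of_lt (by omega)]; omega
  -- Reflection exchanges the lowest i residues with the highest i, so height at least 1 after i
  -- steps becomes the parking inequality at threshold m - i.
  have hcount : ∀ i, 1 ≤ i → i ≤ m →
      (Finset.univ.filter fun l => (-1 - c l - u).val < i).card +
        (Finset.univ.filter fun l => (c l - -u).val < m - i).card = n := by
    intro i h1 h2
    have e : (Finset.univ.filter fun l => (-1 - c l - u).val < i) =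
        Finset.univ.filter fun l => ¬ (c l - -u).val < m - i := by
      refine Finset.filter_congr fun l _ => ?_
      have := hval (c l - -u)
      rw [show (-1 - (c l - -u) : ZMod m) = -1 - c l - u by ring] at this
      omega
    rw [e, add_comm, Finset.card_filter_add_card_filter_not]; simp
  have hiff : ParkCond r (fun l => c l - -u) ↔ WalkGe
      (fun t : ZMod m => 1 - (r : ℤ) * (Finset.univ.filter fun l => -1 - c l = t).card) u 1 := by
    have key : ∀ i, 1 ≤ i → i ≤ m → (((1 : ℕ) : ℤ) ≤ ∑ j ∈ Finset.range i,
        (1 - (r : ℤ) * (Finset.univ.filter fun l => -1 - c l = u + (j : ZMod m)).card) ↔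
        m - i ≤ r * (Finset.univ.filter fun l => (c l - -u).val < m - i).card) := by
      intro i h1 h2
      rw [Finset.sum_sub_distrib, ← Finset.mul_sum, ← Nat.cast_sum,
        sum_range_card_fiber (fun l => -1 - c l) u h2]
      have h3 := congrArg (r * ·) (hcount i h1 h2)
      simp only [mul_add] at h3
      simp only [Finset.sum_const, Finset.card_range, nsmul_eq_mul, mul_one, ← Nat.cast_mul]
      omega
    constructor
    · intro hp i hi
      rw [Finset.mem_Icc] at hi
      exact (key i hi.1 hi.2).2 (hp (m - i) (by omega))
    · intro hp i hi
      have := (key (m - i) (by omega) (by omega)).1 (hp (m - i) (Finset.mem_Icc.2 (by omega)))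
      rwa [show m - (m - i) = i by omega] at this
  simp only [Equiv.neg_apply, hiff]
  rw [Finset.card_filter, Finset.Icc_self, Finset.sum_singleton]

/-- Averaging over the translates of a translation-invariant family of residue tuples. -/
theorem mul_sum_eq_of_translates (S : Finset (Fin n → ZMod m))
    (hS : ∀ (c : Fin n → ZMod m) (u : ZMod m), (fun l => c l - u) ∈ S ↔ c ∈ S) (F : (Fin n → ZMod m) → ℕ) (K : ℕ)
    (hF : ∀ c : Fin n → ZMod m, ∑ u : ZMod m, F (fun l => c l - u) = K) : m * ∑ c ∈ S, F c = K * S.card := by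
  have h1 : ∑ c ∈ S, ∑ u : ZMod m, F (fun l => c l - u) = K * S.card := by
    simp [hF, mul_comm]
  rw [← h1, Finset.sum_comm]
  have h2 : ∀ u : ZMod m, ∑ c ∈ S, F (fun l => c l - u) = ∑ c ∈ S, F c := by
    intro u
    refine Finset.sum_nbij' (fun c l => c l - u) (fun c l => c l + u) ?_ ?_ ?_ ?_ ?_
    · intro c hc; exact (hS c u).2 hc
    · intro c hc; exact (hS _ u).1 (by simpa using hc)
    · intro c _; simp
    · intro c _; simp
    · intro c _; rfl
  simp [h2, ZMod.card]

end CycleLemma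
end ParkingDual

namespace ParkingDual
open Equiv

/-! ### Sorted conditions rewritten as counting conditions -/

section Sequences

variable {n r k : ℕ}

theorem qmin_le_iff (hr : 0 < r) (w q : ℕ) : qmin r w ≤ q ↔ w ≤ q * r := by
  have hne : {q : ℕ | w ≤ q * r}.Nonempty := ⟨w, Nat.le_mul_of_pos_right w hr⟩
  constructor
  · intro h
    exact (Nat.sInf_mem hne : w ≤ qmin r w * r).trans (Nat.mul_le_mul_right r h)
  · intro h
    exact Nat.sInf_le h

theorem qmin_pos (hr : 0 < r) {w : ℕ} (hw : 1 ≤ w) : 1 ≤ qmin r w := by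
  by_contra h
  have := (qmin_le_iff hr w 0).1 (by omega)
  omega

theorem qmin_le_length (hr : 0 < r) (hpos : 0 < (r : ℤ) * n - k) {w : ℕ} (hw : w ≤ k) :
    qmin r w ≤ n := by
  rw [qmin_le_iff hr]
  zify
  linarith [(Nat.cast_le (α := ℤ)).2 hw]

theorem le_dualBound (hr : 0 < r) (hpos : 0 < (r : ℤ) * n - k) {w j : ℕ}
    (hj : qmin r w + 1 ≤ j) : (w : ℤ) ≤ dualBound r k n w j := by
  refine le_min ?_ (by omega)
  have := (qmin_le_iff hr w (j - 1)).1 (by omega)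
  zify [show 1 ≤ j by omega] at this
  exact this

theorem bound_iff_bound_of_lt (hr : 0 < r) (hpos : 0 < (r : ℤ) * n - k) {b : Fin n → ℤ} {w : ℕ}
    (hb : ∀ i : Fin n, (i : ℕ) + 1 ≤ qmin r w → b i = w) :
    (∀ i : Fin n, qmin r w + 1 ≤ (i : ℕ) + 1 → b i ≤ dualBound r k n w (i + 1)) ↔
      ∀ i : Fin n, (w : ℤ) < b i → b i ≤ dualBound r k n w (i + 1) := by
  constructor
  · intro h i hi
    by_cases hq : (i : ℕ) + 1 ≤ qmin r w
    · have := hb i hq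
      omega
    · exact h i (by omega)
  · intro h i hi
    rcases lt_or_ge (w : ℤ) (b i) with hw | hw
    · exact h i hw
    · exact hw.trans (le_dualBound hr hpos hi)

theorem incr_monotone (a : Fin n → ℤ) : Monotone (incr a) := Tuple.monotone_sort a

theorem incr_eq_self {b : Fin n → ℤ} (hb : Monotone b) : incr b = b := by
  rw [incr, Tuple.sort_eq_refl_iff_monotone.2 hb]; rfl

theorem isDualForm_iff (hn : 0 < n) (hr : 0 < r) (hpos : 0 < (r : ℤ) * n - k) {b : Fin n → ℤ}
    (hb : Monotone b) : IsDualForm r k n b ↔ ∃ w : ℕ, 1 ≤ w ∧ w ≤ k ∧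
      (b ⟨0, hn⟩ = w ∧ b ⟨n - 1, Nat.sub_lt hn one_pos⟩ - b ⟨0, hn⟩ < (r : ℤ) * n - k) ∧
      (∃ i : Fin n, (i : ℕ) + 1 = qmin r w ∧ b i = w) ∧
      (∀ i : Fin n, (w : ℤ) < b i → b i ≤ (i : ℤ) * r) := by
  refine exists_congr fun w => and_congr_right fun hw1 => and_congr_right fun hwk => ?_
  have hq1 := qmin_pos hr hw1
  have hqn := qmin_le_length hr hpos hwk
  constructor
  · rintro ⟨h1, h2⟩
    rw [bound_iff_bound_of_lt hr hpos h1] at h2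
    have h0 : b ⟨0, hn⟩ = w := h1 _ hq1
    refine ⟨⟨h0, ?_⟩, ⟨⟨qmin r w - 1, by omega⟩, Nat.sub_add_cancel hq1,
      h1 _ (Nat.sub_add_cancel hq1).le⟩, ?_⟩
    · rcases lt_or_ge (w : ℤ) (b ⟨n - 1, Nat.sub_lt hn one_pos⟩) with hw | hw
      · have := (h2 _ hw).trans (min_le_right _ _)
        omega
      · omega
    · intro i hi
      have := (h2 i hi).trans (min_le_left _ _)
      push_cast at this
      rwa [add_sub_cancel_right] at this
  · rintro ⟨⟨h0, hl⟩, ⟨i₀, hi₀, hbi₀⟩, h3⟩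
    have h1 : ∀ i : Fin n, (i : ℕ) + 1 ≤ qmin r w → b i = w := by
      intro i hi
      apply le_antisymm
      · rw [← hbi₀]
        exact hb (Fin.le_def.2 (by omega))
      · rw [← h0]
        exact hb (Fin.le_def.2 (Nat.zero_le _))
    refine ⟨h1, (bound_iff_bound_of_lt hr hpos h1).2 fun i hi => le_min ?_ ?_⟩
    · push_cast
      rw [add_sub_cancel_right]
      exact h3 i hi
    · have : b i ≤ b ⟨n - 1, Nat.sub_lt hn one_pos⟩ := hb (Fin.le_def.2 (Nat.le_sub_one_of_lt i.2))
      omega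

/-- In an increasing sequence, bounds by the position of an entry amount to bounds by the number
of smaller entries. -/
theorem le_position_iff_le_card {b : Fin n → ℤ} (hb : Monotone b) (e w : ℤ) :
    (∀ i : Fin n, w < b i → b i ≤ e + (i : ℤ) * r) ↔
      ∀ i : Fin n, w < b i → b i ≤ e + r * (Finset.univ.filter fun l => b l < b i).card := by
  have hcard : ∀ i : Fin n, (Finset.univ.filter fun l => b l < b i).card ≤ i := by
    intro i
    rw [← Fin.card_Iio]
    refine Finset.card_le_card fun l hl => ?_
    rw [Finset.mem_Iio]
    by_contra h
    exact absurd (hb (not_lt.1 h)) (not_le.2 (Finset.mem_filter.1 hl).2)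
  constructor
  · intro h i hi
    have hj := hcard i
    -- The first position carrying the value b i, where the position bound is sharpest.
    set j : Fin n := ⟨(Finset.univ.filter fun l => b l < b i).card, hj.trans_lt i.2⟩ with hjdef
    have hji : b j = b i := by
      refine le_antisymm (hb (Fin.le_def.2 hj)) ?_
      by_contra hlt
      have : (Finset.Iic j).card ≤ (Finset.univ.filter fun l => b l < b i).card := by
        refine Finset.card_le_card fun l hl => ?_
        rw [Finset.mem_filter]
        exact ⟨Finset.mem_univ _, (hb (Finset.mem_Iic.1 hl)).trans_lt (not_le.1 hlt)⟩
      rw [Fin.card_Iic] at this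
      simp [hjdef] at this
    have := h j (by rwa [hji])
    rw [hji] at this
    simpa [hjdef, mul_comm] using this
  · intro h i hi
    refine (h i hi).trans ?_
    have : ((Finset.univ.filter fun l => b l < b i).card : ℤ) ≤ i := by exact_mod_cast hcard i
    have := mul_le_mul_of_nonneg_left this (Nat.cast_nonneg (α := ℤ) r)
    linarith

theorem card_incr_lt (a : Fin n → ℤ) (x : ℤ) :
    (Finset.univ.filter fun l => incr a l < x).card = (Finset.univ.filter fun l => a l < x).card :=
  Finset.card_equiv (Tuple.sort a) fun i => by
    rw [Finset.mem_filter, Finset.mem_filter]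
    simp [incr]

theorem mem_parking_iff {a : Fin n → ℤ} : a ∈ parking r 1 n ↔
    ∀ l, 1 ≤ a l ∧ a l ≤ 1 + r * (Finset.univ.filter fun l' => a l' < a l).card := by
  change ((∀ i, 1 ≤ a i) ∧ ∀ i : Fin n, incr a i ≤ ((1 : ℕ) : ℤ) + (i : ℤ) * r) ↔ _
  rw [forall_and]
  refine and_congr_right fun h => ?_
  have h' : ∀ i, 0 < incr a i := fun i => h _
  have key := le_position_iff_le_card (r := r) (incr_monotone a) 1 0
  simp only [h', true_imp_iff] at key
  rw [Nat.cast_one, key]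
  simp only [card_incr_lt]
  exact (Tuple.sort a).forall_congr_right
    (q := fun l => a l ≤ 1 + r * ((Finset.univ.filter fun l' => a l' < a l).card : ℤ))

/-- Removes the sorting so that membership can be read on residues; w is forced to be the least
entry. Condition II is absent because it follows from the others. -/
theorem mem_dualSet_iff (hn : 0 < n) (hr : 0 < r) (hpos : 0 < (r : ℤ) * n - k) {a : Fin n → ℤ} :
    a ∈ dualSet r k n ↔ ∃ v : ℕ, 1 ≤ v ∧ v ≤ k ∧ (∃ l, a l = v) ∧
      (∀ l, (v : ℤ) ≤ a l ∧ a l < v + ((r : ℤ) * n - k)) ∧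
      ∀ l, (v : ℤ) < a l → a l ≤ r * (Finset.univ.filter fun l' => a l' < a l).card := by
  have hmono := incr_monotone a
  have hσ : ∀ l, incr a ((Tuple.sort a).symm l) = a l := by simp [incr]
  change IsDualForm r k n (incr a) ↔ _
  rw [isDualForm_iff hn hr hpos hmono]
  refine exists_congr fun w => and_congr_right fun hw1 => and_congr_right fun hwk => ?_
  have key := le_position_iff_le_card (r := r) hmono 0 w
  have hkey : (∀ i : Fin n, (w : ℤ) < incr a i → incr a i ≤ (i : ℤ) * r) ↔
      ∀ l, (w : ℤ) < a l → a l ≤ r * (Finset.univ.filter fun l' => a l' < a l).card := by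
    simp only [zero_add] at key
    rw [key]
    simp only [card_incr_lt]
    exact (Tuple.sort a).forall_congr_right (q := fun l => (w : ℤ) < a l →
      a l ≤ r * ((Finset.univ.filter fun l' => a l' < a l).card : ℤ))
  rw [← hkey]
  constructor
  · rintro ⟨⟨h0, hl⟩, -, h3⟩
    refine ⟨⟨_, h0⟩, fun l => ?_, h3⟩
    rw [← hσ l]
    have h1 := hmono (Fin.le_def.2 (Nat.zero_le _) : ⟨0, hn⟩ ≤ (Tuple.sort a).symm l)
    have h2 := hmono (Fin.le_def.2 (Nat.le_sub_one_of_lt ((Tuple.sort a).symm l).2) :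
      (Tuple.sort a).symm l ≤ ⟨n - 1, Nat.sub_lt hn one_pos⟩)
    omega
  · rintro ⟨⟨l, hl⟩, h2, h3⟩
    have h0 : incr a ⟨0, hn⟩ = w := by
      refine le_antisymm ?_ (h2 _).1
      rw [← hl, ← hσ l]
      exact hmono (Fin.le_def.2 (Nat.zero_le _))
    have hq1 := qmin_pos hr hw1
    have hqn := qmin_le_length hr hpos hwk
    refine ⟨⟨h0, ?_⟩, ⟨⟨qmin r w - 1, by omega⟩, Nat.sub_add_cancel hq1, ?_⟩, h3⟩
    · have := (h2 (Tuple.sort a ⟨n - 1, Nat.sub_lt hn one_pos⟩)).2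
      change incr a ⟨n - 1, Nat.sub_lt hn one_pos⟩ < _ at this
      omega
    -- If the entry at position q(w) exceeded w, condition III would give w < (q(w) - 1) r, against
    -- the minimality of q(w).
    · by_contra hne
      have hlt : (w : ℤ) < incr a ⟨qmin r w - 1, by omega⟩ := lt_of_le_of_ne (h2 _).1 (Ne.symm hne)
      have h4 := hlt.trans_le (h3 _ hlt)
      have h5 : w < (qmin r w - 1) * r := by exact_mod_cast h4
      have := (qmin_le_iff hr w _).2 h5.le
      omega

/-- Lower bounds for all counting thresholds need only be checked at the entries. -/
theorem forall_le_card_iff (f : Fin n → ℕ) (v lo hi : ℕ) (hn : ∀ i ≤ hi, v + i ≤ r * n)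
    (hf : ∀ l, f l ≤ hi) :
    (∀ i, lo ≤ i → i ≤ hi → v + i ≤ r * (Finset.univ.filter fun l => f l < i).card) ↔
      ∀ l, lo ≤ f l → v + f l ≤ r * (Finset.univ.filter fun l' => f l' < f l).card := by
  constructor
  · intro h l hl
    exact h _ hl (hf l)
  · intro h i h1 h2
    by_cases hex : ∃ l, i ≤ f l
    · obtain ⟨l, hl, hmin⟩ := Finset.exists_min_image (Finset.univ.filter fun l => i ≤ f l) f
        (by obtain ⟨l, hl⟩ := hex; exact ⟨l, by simpa using hl⟩)
      have hl' : i ≤ f l := by simpa using hl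
      have e : (Finset.univ.filter fun l' => f l' < f l) =
          Finset.univ.filter fun l' => f l' < i := by
        refine Finset.filter_congr fun l' _ => ⟨fun h' => ?_, fun h' => h'.trans_le hl'⟩
        by_contra hc
        exact absurd (hmin l' (by simpa using hc)) (not_le.2 h')
      have := h l (h1.trans hl')
      rw [e] at this
      omega
    · push Not at hex
      rw [Finset.filter_true_of_mem fun l _ => hex l]
      simpa using hn i h2

end Sequences

/-! ### Fixed points as invariant residue tuples, and the conclusion -/

section FixedPoints

variable {n r k m : ℕ}

theorem mem_fixedBy_iff {S : SubMulAction (Perm (Fin n)) (Fin n → ℤ)} {w : Perm (Fin n)} {a : S} :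
    a ∈ MulAction.fixedBy S w ↔ ∀ i, a.1 (w i) = a.1 i := by
  rw [MulAction.mem_fixedBy, Subtype.ext_iff, funext_iff]
  change (∀ i, a.1 (w⁻¹ i) = a.1 i) ↔ _
  constructor
  · intro h i
    simpa using (h (w i)).symm
  · intro h i
    simpa using (h (w⁻¹ i)).symm

theorem card_val_add_lt (f : Fin n → ℕ) (v x : ℕ) :
    (Finset.univ.filter fun l => ((v : ℤ) + f l) < v + x).card =
      (Finset.univ.filter fun l => f l < x).card := by
  congr 1
  refine Finset.filter_congr fun l _ => ?_
  omega

theorem val_add_mem_parking_iff [NeZero m] (h : r * n + 1 = m) (c : Fin n → ZMod m) :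
    (fun l => (1 : ℤ) + (c l).val) ∈ parking r 1 n ↔ ParkCond r c := by
  have key := forall_le_card_iff (r := r) (fun l => (c l).val) 0 0 (r * n)
    (fun i hi => by omega) (fun l => by have := ZMod.val_lt (c l); omega)
  have h1 : ParkCond r c ↔ ∀ i, 0 ≤ i → i ≤ r * n →
      0 + i ≤ r * (Finset.univ.filter fun l => (c l).val < i).card := by
    refine forall_congr' fun i => ?_
    simp only [zero_le, true_imp_iff, zero_add, ← h, Nat.lt_succ_iff]
  rw [h1, key, mem_parking_iff]
  refine forall_congr' fun l => ?_
  have e := card_val_add_lt (fun l => (c l).val) 1 (c l).val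
  rw [Nat.cast_one] at e
  rw [e]
  zify
  constructor
  · intro h _; omega
  · intro h; have := h (by positivity); omega

/-- The threshold 1 already requires a zero residue. Hence v is the least entry of v + c, and the
pair (c, v) can be recovered from that tuple. -/
theorem DualCond.exists_eq_zero [NeZero m] {c : Fin n → ZMod m} {v : ℕ}
    (h : DualCond r c v) : ∃ l, c l = 0 := by
  have h1 := h 1 (Finset.mem_Icc.2 ⟨le_rfl, Nat.one_le_iff_ne_zero.2 (NeZero.ne m)⟩)
  by_contra hc
  push Not at hc
  rw [Finset.filter_false_of_mem fun l _ => by simpa using hc l] at h1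
  simp at h1

/-- At the threshold m, which no residue attains, the inequality reads v + m ≤ rn, that is, v ≤ k.
-/
theorem dualCond_iff [NeZero m] (h : r * n = k + m) (c : Fin n → ZMod m) {v : ℕ} (hv : v ≤ k) :
    DualCond r c v ↔ ∀ l, 1 ≤ (c l).val →
      v + (c l).val ≤ r * (Finset.univ.filter fun l' => (c l').val < (c l).val).card := by
  have key := forall_le_card_iff (r := r) (fun l => (c l).val) v 1 m
    (fun i hi => by omega) (fun l => (ZMod.val_lt (c l)).le)
  rw [← key]
  simp only [DualCond, Finset.mem_Icc, and_imp]

theorem val_add_mem_dualSet [NeZero m] (hn : 0 < n) (hr : 0 < r) (h : r * n = k + m)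
    {c : Fin n → ZMod m} {v : ℕ} (hv1 : 1 ≤ v) (hv : v ≤ k) (hc : DualCond r c v) :
    (fun l => (v : ℤ) + (c l).val) ∈ dualSet r k n := by
  have hm : (r : ℤ) * n - k = m := by zify at h; omega
  have hm0 := Nat.pos_of_ne_zero (NeZero.ne m)
  rw [mem_dualSet_iff hn hr (by omega)]
  refine ⟨v, hv1, hv, ?_, fun l => ?_, fun l hl => ?_⟩
  · obtain ⟨l, hl⟩ := hc.exists_eq_zero
    exact ⟨l, by simp [hl]⟩
  · have := ZMod.val_lt (c l)
    omega
  · rw [card_val_add_lt (fun l => (c l).val)]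
    exact_mod_cast (dualCond_iff h c hv).1 hc l (by omega)

theorem exists_val_add_eq_of_mem_dualSet [NeZero m] (hn : 0 < n) (hr : 0 < r)
    (h : r * n = k + m) {a : Fin n → ℤ} (ha : a ∈ dualSet r k n) :
    ∃ (c : Fin n → ZMod m) (v : ℕ), 1 ≤ v ∧ v ≤ k ∧ DualCond r c v ∧
      a = fun l => (v : ℤ) + (c l).val := by
  have hm : (r : ℤ) * n - k = m := by zify at h; omega
  have hm0 := Nat.pos_of_ne_zero (NeZero.ne m)
  obtain ⟨v, hv1, hvk, -, h2, h3⟩ := (mem_dualSet_iff hn hr (by omega)).1 ha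
  have hval : ∀ l, (((a l - v).toNat : ZMod m)).val = (a l - v).toNat := fun l =>
    ZMod.val_cast_of_lt (by have := h2 l; omega)
  have hae : a = fun l => (v : ℤ) + (((a l - v).toNat : ZMod m)).val := by
    funext l
    rw [hval]
    have := h2 l
    omega
  refine ⟨fun l => ((a l - v).toNat : ZMod m), v, hv1, hvk, ?_, hae⟩
  rw [dualCond_iff h _ hvk]
  intro l hl
  have h4 := h3 l (by rw [hval] at hl; omega)
  rw [hae] at h4
  simp only at h4
  rw [card_val_add_lt (fun l => (((a l - v).toNat : ZMod m)).val)] at h4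
  exact_mod_cast h4

-- The bijection (c, v) ↦ v + c commutes with permuting coordinates, so a tuple is fixed exactly
-- when its residue tuple is.
open Classical in
theorem card_fixedBy_dualSet [NeZero m] (hn : 0 < n) (hr : 0 < r) (h : r * n = k + m)
    (w : Perm (Fin n)) : Nat.card (MulAction.fixedBy (dualSet r k n) w) =
      ∑ c ∈ Finset.univ.filter (fun c : Fin n → ZMod m => ∀ i, c (w i) = c i),
        ((Finset.Icc 1 k).filter fun v => DualCond r c v).card := by
  rw [← Finset.card_sigma, ← Fintype.card_coe, ← Nat.card_eq_fintype_card]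
  symm
  have hmem : ∀ p : Σ _ : Fin n → ZMod m, ℕ,
      p ∈ (Finset.univ.filter (fun c : Fin n → ZMod m => ∀ i, c (w i) = c i)).sigma
        (fun c => (Finset.Icc 1 k).filter fun v => DualCond r c v) ↔
      (∀ i, p.1 (w i) = p.1 i) ∧ (1 ≤ p.2 ∧ p.2 ≤ k) ∧ DualCond r p.1 p.2 := by
    intro p; simp
  refine Nat.card_eq_of_bijective (fun p => ⟨⟨fun l => (p.1.2 : ℤ) + (p.1.1 l).val,
    val_add_mem_dualSet hn hr h ((hmem _).1 p.2).2.1.1 ((hmem _).1 p.2).2.1.2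
      ((hmem _).1 p.2).2.2⟩, ?_⟩) ⟨?_, ?_⟩
  · rw [mem_fixedBy_iff]
    intro i
    simp only [((hmem _).1 p.2).1 i]
  · rintro ⟨⟨c, v⟩, hp⟩ ⟨⟨d, u⟩, hq⟩ heq
    simp only [Subtype.mk.injEq] at heq
    obtain ⟨l, hl⟩ := ((hmem _).1 hp).2.2.exists_eq_zero
    obtain ⟨l', hl'⟩ := ((hmem _).1 hq).2.2.exists_eq_zero
    simp only at hl hl'
    have e1 := congrFun heq l
    have e2 := congrFun heq l'
    simp only [hl, hl', ZMod.val_zero] at e1 e2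
    obtain rfl : v = u := by omega
    obtain rfl : c = d := by
      funext i
      have := congrFun heq i
      exact ZMod.val_injective m (by omega)
    rfl
  · rintro ⟨⟨a, ha⟩, hfix⟩
    rw [mem_fixedBy_iff] at hfix
    obtain ⟨c, v, hv1, hvk, hc, rfl⟩ := exists_val_add_eq_of_mem_dualSet (m := m) hn hr h ha
    refine ⟨⟨⟨c, v⟩, (hmem _).2 ⟨fun i => ?_, ⟨hv1, hvk⟩, hc⟩⟩, rfl⟩
    have := hfix i
    simp only at this ⊢
    exact ZMod.val_injective m (by omega)

open Classical in
theorem card_fixedBy_parking [NeZero m] (h : r * n + 1 = m)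
    (w : Perm (Fin n)) : Nat.card (MulAction.fixedBy (parking r 1 n) w) =
      ∑ c ∈ Finset.univ.filter (fun c : Fin n → ZMod m => ∀ i, c (w i) = c i),
        if ParkCond r c then 1 else 0 := by
  rw [← Finset.card_filter, Finset.filter_filter, ← Fintype.card_coe, ← Nat.card_eq_fintype_card]
  symm
  have hmem : ∀ c : Fin n → ZMod m,
      c ∈ Finset.univ.filter (fun c : Fin n → ZMod m => (∀ i, c (w i) = c i) ∧ ParkCond r c) ↔
      (∀ i, c (w i) = c i) ∧ ParkCond r c := by
    intro p; simp
  refine Nat.card_eq_of_bijective (fun p => ⟨⟨fun l => (1 : ℤ) + (p.1 l).val,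
    (val_add_mem_parking_iff h p.1).2 ((hmem _).1 p.2).2⟩, ?_⟩) ⟨?_, ?_⟩
  · rw [mem_fixedBy_iff]
    intro i
    simp only [((hmem _).1 p.2).1 i]
  · rintro ⟨c, hp⟩ ⟨d, hq⟩ heq
    simp only [Subtype.mk.injEq] at heq
    refine Subtype.ext (funext fun i => ZMod.val_injective m ?_)
    have := congrFun heq i
    simp only at this ⊢
    omega
  · rintro ⟨⟨a, ha⟩, hfix⟩
    rw [mem_fixedBy_iff] at hfix
    -- Entries lie between 1 and rn + 1 = m, so subtracting 1 loses nothing modulo m.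
    have hle : ∀ l, 1 ≤ a l ∧ a l ≤ 1 + r * n := fun l => by
      refine ⟨(mem_parking_iff.1 ha l).1, (mem_parking_iff.1 ha l).2.trans ?_⟩
      have : (Finset.univ.filter fun l' => a l' < a l).card ≤ n := by
        simpa using Finset.card_le_univ (Finset.univ.filter fun l' => a l' < a l)
      have := Nat.mul_le_mul_left r this
      zify at this
      omega
    have hval : ∀ l, (((a l - 1).toNat : ZMod m)).val = (a l - 1).toNat := fun l =>
      ZMod.val_cast_of_lt (by have := hle l; zify at h; omega)
    have hae : a = fun l => (1 : ℤ) + (((a l - 1).toNat : ZMod m)).val := by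
      funext l
      rw [hval]
      have := hle l
      omega
    refine ⟨⟨fun l => ((a l - 1).toNat : ZMod m), (hmem _).2 ⟨fun i => ?_, ?_⟩⟩, ?_⟩
    · have := hfix i
      simp only at this ⊢
      rw [this]
    · rw [← val_add_mem_parking_iff h, ← hae]
      exact ha
    · exact Subtype.ext (Subtype.ext hae.symm)

theorem card_invariant_eq [NeZero m] (w : Perm (Fin n)) :
    (Finset.univ.filter (fun c : Fin n → ZMod m => ∀ i, c (w i) = c i)).card =
      Nat.card {c : Fin n → ZMod m // ∀ i, c (w i) = c i} := by
  rw [Nat.card_eq_fintype_card, Fintype.card_subtype]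

/-- The residue tuples invariant under a permutation are closed under translation, so the cycle
lemma can be averaged over each fixed-point set. -/
theorem mul_frobeniusChar_dualSet [NeZero m] (hn : 0 < n) (hr : 0 < r) (h : r * n = k + m) :
    (m : SymRing) * frobeniusChar n (dualSet r k n) = k * tupleSym m n := by
  classical
  have := natCast_mul_frobeniusChar (β := ZMod m) (m := m) (k := k) (dualSet r k n) fun w => by
    rw [card_fixedBy_dualSet hn hr h, ← card_invariant_eq,
      mul_sum_eq_of_translates _ (by simp) _ k (sum_card_dualCond h)]
  rwa [ZMod.card] at this

theorem mul_parkingSym [NeZero m] (h : r * n + 1 = m) :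
    (m : SymRing) * parkingSym r 1 n = tupleSym m n := by
  classical
  have := natCast_mul_frobeniusChar (β := ZMod m) (m := m) (k := 1) (parking r 1 n) fun w => by
    rw [card_fixedBy_parking h, ← card_invariant_eq,
      mul_sum_eq_of_translates _ (by simp) _ 1 (sum_parkCond h)]
  rwa [ZMod.card, Nat.cast_one, one_mul] at this

theorem finite_dualSet (hn : 0 < n) (hr : 0 < r) (hpos : 0 < (r : ℤ) * n - k) :
    Finite (dualSet r k n) := by
  refine Set.Finite.subset (Set.finite_Icc (fun _ => (0 : ℤ)) (fun _ => (r : ℤ) * n)) ?_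
  intro a ha
  obtain ⟨v, -, hvk, -, h2, -⟩ := (mem_dualSet_iff hn hr hpos).1 ha
  constructor <;> intro l <;> have := h2 l <;> simp only <;> omega

theorem dualSym_eq_frobeniusChar (hn : 0 < n) (hr : 0 < r) (hpos : 0 < (r : ℤ) * n - k) :
    dualSym r k n = frobeniusChar n (dualSet r k n) := by
  obtain ⟨m, hm⟩ : ∃ m : ℕ, (m : ℤ) = (r : ℤ) * n - k := ⟨_, Int.toNat_of_nonneg hpos.le⟩
  have hm0 : m ≠ 0 := by omega
  have : NeZero m := ⟨hm0⟩
  have h : r * n = k + m := by zify; omega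
  refine eq_of_natCast_mul_eq hm0 ?_
  rw [mul_frobeniusChar_dualSet hn hr h, ← coeff_homSeries_pow, dualSym]
  refine coeff_inv_pow_of_coeff homSeries (parkingSeries r) (negPow r k) r k
    constantCoeff_homSeries (constantCoeff_parkingSeries r) (fun j => ?_)
    (parkingSeries_pow_mul_negPow r k) n m hn.ne' hm0 h
  rw [coeff_homSeries_pow, parkingSeries, PowerSeries.coeff_mk, mul_parkingSym rfl]

end FixedPoints
end ParkingDual

open ParkingDual in
theorem theorem4p1 (n r k : ℕ) (hn : 0 < n) (hr : 0 < r) (hk : 0 < k)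
    (hpos : 0 < (r : ℤ) * n - k) :
    -- the set is finite, and the symmetric function is the Frobenius characteristic of the action
    (Finite (dualSet r k n) ∧ dualSym r k n = frobeniusChar n (dualSet r k n)) ∧
    -- the stated facts about `q(w)` and the bounds
    (∀ w : ℕ, 1 ≤ w → w ≤ k → qmin r w ≤ n ∧
      ∀ j : ℕ, qmin r w + 1 ≤ j → (w : ℤ) ≤ dualBound r k n w j) ∧
    -- the bounds need only be required of the entries larger than `w`
    (∀ b : Fin n → ℤ, Monotone b → ∀ w : ℕ, 1 ≤ w → w ≤ k →
      (∀ i : Fin n, (i : ℕ) + 1 ≤ qmin r w → b i = w) →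
      ((∀ i : Fin n, qmin r w + 1 ≤ (i : ℕ) + 1 → b i ≤ dualBound r k n w (i + 1)) ↔
        (∀ i : Fin n, (w : ℤ) < b i → b i ≤ dualBound r k n w (i + 1)))) ∧
    -- the description of the weakly increasing members by the properties I, II, III
    (∀ b : Fin n → ℤ, Monotone b →
      (b ∈ dualSet r k n ↔ ∃ w : ℕ, 1 ≤ w ∧ w ≤ k ∧
        (b ⟨0, hn⟩ = w ∧ b ⟨n - 1, Nat.sub_lt hn one_pos⟩ - b ⟨0, hn⟩ < (r : ℤ) * n - k) ∧
        (∃ i : Fin n, (i : ℕ) + 1 = qmin r w ∧ b i = w) ∧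
        (∀ i : Fin n, (w : ℤ) < b i → b i ≤ (i : ℤ) * r))) := by
  refine ⟨⟨finite_dualSet hn hr hpos, dualSym_eq_frobeniusChar hn hr hpos⟩,
    fun w _ hw => ⟨qmin_le_length hr hpos hw, fun j hj => le_dualBound hr hpos hj⟩,
    fun b _ w _ _ hb => bound_iff_bound_of_lt hr hpos hb, fun b hb => ?_⟩
  rw [← isDualForm_iff hn hr hpos hb]
  change IsDualForm r k n (incr b) ↔ _
  rw [incr_eq_self hb]
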